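/- \textbf{Definitions.} A \emph{partial groupoid} $\langle E,\circ\rangle$ is a set $E$ with a partial binary operation $\circ$, whose domain is denoted $D_E\subseteq E\times E$. (We write $ef$ for $e\circ f$ in the axioms below.) Put $$e\mathrel{\omega^r}f\iff (f,e)\in D_E \text{ and } fe=e,\qquad e\mathrel{\omega^l}f\iff (e,f)\in D_E\text{ and } ef=e,$$ $\omega=\omega^r\cap\omega^l$, $\mathcal R=\omega^r\cap(\omega^r)^{-1}$, $\mathcal L=\omega^l\cap(\omega^l)^{-1}$, and $\omega^r(e)=\{f\in E: f\mathrel{\omega^r}e\}$. An (abstract) \emph{biordered set} is a partial groupoid $\langle E,\circ\rangle$ such that the following axioms and their left-right duals hold for all $e,f,g\in E$: \begin{itemize} \item[(B1)] $\omega^r$ and $\omega^l$ are reflexive and transitive, and $D_E=(\omega^r\cup\omega^l)\cup(\omega^r\cup\omega^l)^{-1}$; \item[(B21)] if $f\in\omega^r(e)$, then $f\mathrel{\mathcal R}fe\mathrel{\omega}e$; \item[(B22)] if $g\mathrel{\omega^l}f$ and $f,g\in\omega^r(e)$, then $ge\mathrel{\omega^l}fe$; \item[(B31)] if $g\mathrel{\omega^r}f$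 and $f\mathrel{\omega^r}e$, then $gf=(ge)f$; \item[(B32)] if $g\mathrel{\omega^l}f$ and $f,g\in\omega^r(e)$, then $(fg)e=(fe)(ge)$; \item[(B4)] if $f,g\in\omega^r(e)$ and $ge\mathrel{\omega^l}fe$, then there is $g'\in\omega^r(e)$ such that $g'\mathrel{\omega^l}f$ and $g'e=ge$. \end{itemize} The \emph{free idempotent generated semigroup} on $E$ is the semigroup with presentation $$IG(E)=\langle E\mid ef=e\circ f\ \text{ whenever } e\circ f \text{ is defined in } E\rangle .$$ An element $a$ of a semigroup $S$ is \emph{periodic} if the subsemigroup of $S$ generated by $a$ is finite; its \emph{index} is then the least positive integer $h$ such that $a^h=a^{h+d}$ for some positive integer $d$. A \emph{subgroup} of $S$ is a subsemigroup of $S$ that is a group under the multiplication of $S$ (its identity element need not be an identity of $S$). \textbf{Theorem.} Let $\langle E,\circ\rangle$ be a biordered set and let $IG(E)$ be the free idempotent generated semigroup on $E$. Every periodic element of $IG(E)$ lies in a subgroup of $IG(E)$; in other words, every periodic element of $IG(E)$ has index $1$. -/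

import Mathlib

/-- A partial groupoid: a set with a partial binary operation `e ∘ f`. `Dom e f` says that `e ∘ f` is
defined, and in that case its value is `op e f`. The values of `op` outside `Dom` carry no
information: every use of `op e f` below is at a pair at which the product is defined. -/
class PartialGroupoid (E : Type*) where
  /-- the product `e ∘ f` is defined -/
  Dom : E → E → Prop
  /-- the value of the product `e ∘ f` where it is defined -/
  op : E → E → E

namespace PartialGroupoid

variable {E : Type*} [PartialGroupoid E]

/-- `e ωʳ f`: the product `f ∘ e` is defined and equals `e`. -/
def OmegaR (e f : E) : Prop := Dom f e ∧ op f e = e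

/-- `e ωˡ f`: the product `e ∘ f` is defined and equals `e`. -/
def OmegaL (e f : E) : Prop := Dom e f ∧ op e f = e

/-- `e ω f`, where `ω = ωʳ ∩ ωˡ`. -/
def Omega (e f : E) : Prop := OmegaR e f ∧ OmegaL e f

/-- `e 𝓡 f`, where `𝓡 = ωʳ ∩ (ωʳ)⁻¹`. -/
def RelR (e f : E) : Prop := OmegaR e f ∧ OmegaR f e

/-- `e 𝓛 f`, where `𝓛 = ωˡ ∩ (ωˡ)⁻¹`. -/
def RelL (e f : E) : Prop := OmegaL e f ∧ OmegaL f e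

end PartialGroupoid

open PartialGroupoid in
/-- An (abstract) biordered set: a partial groupoid that satisfies the biorder axioms
(B1), (B21), (B22), (B31), (B32), (B4) and their left-right duals. -/
class BiorderedSet (E : Type*) extends PartialGroupoid E where
  /-- (B1) `ωʳ` and `ωˡ` are quasiorders, and `Dom = (ωʳ ∪ ωˡ) ∪ (ωʳ ∪ ωˡ)⁻¹`. -/
  omegaR_refl : ∀ e : E, OmegaR e e
  omegaR_trans : ∀ e f g : E, OmegaR e f → OmegaR f g → OmegaR e g
  omegaL_refl : ∀ e : E, OmegaL e e
  omegaL_trans : ∀ e f g : E, OmegaL e f → OmegaL f g → OmegaL e g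
  dom_iff : ∀ e f : E, Dom e f ↔ OmegaR e f ∨ OmegaL e f ∨ OmegaR f e ∨ OmegaL f e
  /-- (B21) if `f ωʳ e` then `f 𝓡 fe ω e`. -/
  b21 : ∀ e f : E, OmegaR f e → RelR f (op f e) ∧ Omega (op f e) e
  /-- dual of (B21) -/
  b21_dual : ∀ e f : E, OmegaL f e → RelL f (op e f) ∧ Omega (op e f) e
  /-- (B22) if `g ωˡ f` and `f, g ∈ ωʳ(e)` then `ge ωˡ fe`. -/
  b22 : ∀ e f g : E, OmegaL g f → OmegaR f e → OmegaR g e → OmegaL (op g e) (op f e)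
  /-- dual of (B22) -/
  b22_dual : ∀ e f g : E, OmegaR g f → OmegaL f e → OmegaL g e → OmegaR (op e g) (op e f)
  /-- (B31) if `g ωʳ f` and `f ωʳ e` then `gf = (ge)f`. -/
  b31 : ∀ e f g : E, OmegaR g f → OmegaR f e → op g f = op (op g e) f
  /-- dual of (B31) -/
  b31_dual : ∀ e f g : E, OmegaL g f → OmegaL f e → op f g = op f (op e g)
  /-- (B32) if `g ωˡ f` and `f, g ∈ ωʳ(e)` then `(fg)e = (fe)(ge)`. -/
  b32 : ∀ e f g : E, OmegaL g f → OmegaR f e → OmegaR g e →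
    op (op f g) e = op (op f e) (op g e)
  /-- dual of (B32) -/
  b32_dual : ∀ e f g : E, OmegaR g f → OmegaL f e → OmegaL g e →
    op e (op g f) = op (op e g) (op e f)
  /-- (B4) if `f, g ∈ ωʳ(e)` and `ge ωˡ fe` then there is `g' ∈ ωʳ(e)` with `g' ωˡ f` and
  `g'e = ge`. -/
  b4 : ∀ e f g : E, OmegaR f e → OmegaR g e → OmegaL (op g e) (op f e) →
    ∃ g' : E, OmegaR g' e ∧ OmegaL g' f ∧ op g' e = op g e
  /-- dual of (B4) -/
  b4_dual : ∀ e f g : E, OmegaL f e → OmegaL g e → OmegaR (op e g) (op e f) →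
    ∃ g' : E, OmegaL g' e ∧ OmegaR g' f ∧ op e g' = op e g

/-- The defining relations `e f = e ∘ f` (whenever `e ∘ f` is defined in `E`). -/
inductive IGRel (E : Type*) [PartialGroupoid E] : FreeSemigroup E → FreeSemigroup E → Prop
  | mul (e f : E) (h : PartialGroupoid.Dom e f) :
      IGRel E (FreeSemigroup.of e * FreeSemigroup.of f)
        (FreeSemigroup.of (PartialGroupoid.op e f))

/-- The free idempotent generated semigroup on `E`: the semigroup with generating set `E` and
relations `e f = e ∘ f` whenever `e ∘ f` is defined in `E`. -/
abbrev IG (E : Type*) [BiorderedSet E] : Type _ := (conGen (IGRel E)).Quotient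

namespace SemigroupElement

variable {S : Type*} [Semigroup S]

/-- An element of a semigroup is periodic if it generates a finite subsemigroup. -/
def IsPeriodic (a : S) : Prop := (Subsemigroup.closure {a} : Set S).Finite

/-- `powSucc a n` is the power `a ^ (n + 1)`. -/
def powSucc (a : S) : ℕ → S
  | 0 => a
  | n + 1 => powSucc a n * a

/-- `ppow a n` is the power `a ^ n` with a positive integer exponent. -/
def ppow (a : S) (n : ℕ+) : S := powSucc a n.natPred

/-- `h` is the index of `a`: the least positive integer `h` such that `a ^ h = a ^ (h + d)` for some
positive integer `d`. -/
def HasIndex (a : S) (h : ℕ+) : Prop :=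
  IsLeast {k : ℕ+ | ∃ d : ℕ+, ppow a k = ppow a (k + d)} h

/-- A subsemigroup `H` of a semigroup is a subgroup if it is a group under the multiplication of the
semigroup: it has an identity element (an idempotent of `S`, in general not an identity of `S`), and
each of its elements has an inverse in `H` with respect to that identity. -/
def IsSubgroup (H : Subsemigroup S) : Prop :=
  ∃ e ∈ H, (∀ x ∈ H, e * x = x ∧ x * e = x) ∧ ∀ x ∈ H, ∃ y ∈ H, x * y = e ∧ y * x = e

end SemigroupElement

/-! Call a letter `f` of a word `p f q` a seed if, in the monoid obtained by adjoining an identity,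
`p f` is 𝓛-related to `f` and `f q` is 𝓡-related to `f`. The least number of seeded blocks into
which a word can be cut depends only on the element it represents: by (B21) and its dual, a defined
product `g = e ∘ f` is 𝓡-related to `e` or 𝓛-related to `f`, so seeds survive replacing `e f` by `g`
and conversely (`IsBasicProduct.seededLength_contract`, `IsBasicProduct.seededLength_expand`,
`seededLength_of_eval_eq`).

Let `w` represent a periodic `a`. Arbitrarily high powers of `a` equal one fixed power, so
arbitrarily long words `w ⋯ w` split into a bounded number of seeded blocks, and one block is much
longer than `w`. On one side of its seed `f` the block contains the rest of that copy of `w` and one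
more full copy (`exists_seed_of_replicate`). Hence `w = u f s` and `b = f s u f` is one-sided
invertible relative to the idempotent `f`. Being periodic as well, `b` has a power equal to `f`, and
inserting that power in `a = u f s` gives `a = a ^ (d + 2)` (`eq_pow_of_seed`). -/

open PartialGroupoid

namespace SeededWord

/-! ### Seeds under contraction and expansion of a product -/

section Monoid

variable {E M : Type*} [Monoid M] (ι : E → M)

/-- The value of a word in a monoid. -/
def eval (l : List E) : M := (l.map ι).prod

@[simp] theorem eval_nil : eval ι [] = 1 := rfl

@[simp] theorem eval_cons (e : E) (l : List E) : eval ι (e :: l) = ι e * eval ι l := by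
  simp [eval]

@[simp] theorem eval_append (l l' : List E) : eval ι (l ++ l') = eval ι l * eval ι l' := by
  simp [eval]

theorem eval_replicate_flatten (n : ℕ) (w : List E) :
    eval ι (List.replicate n w).flatten = eval ι w ^ n := by
  induction n with
  | zero => simp
  | succ n ih => simp [List.replicate_succ, ih, pow_succ']

/-- The letter `f` is a seed of the word `p f q`: `p f` is `𝓛`-related to `f` and `f q` is
`𝓡`-related to `f`. -/
def IsSeed (p : List E) (f : E) (q : List E) : Prop :=
  (∃ z, z * (eval ι p * ι f) = ι f) ∧ ∃ z, ι f * eval ι q * z = ι f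

/-- A word that has a seed. -/
def Seeded (l : List E) : Prop := ∃ p f q, l = p ++ f :: q ∧ IsSeed ι p f q

/-- The word `l` is a concatenation of at most `k` seeded words. -/
def SeededLength (k : ℕ) (l : List E) : Prop :=
  ∃ L : List (List E), L.flatten = l ∧ (∀ w ∈ L, Seeded ι w) ∧ L.length ≤ k

/-- `g` is the product of `e` and `f`, and it is `𝓡`-related to `e` or `𝓛`-related to `f`. -/
def IsBasicProduct (e f g : E) : Prop :=
  ι e * ι f = ι g ∧ ((∃ z, ι g * z = ι e) ∨ ∃ z, z * ι g = ι f)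

variable {ι}

theorem IsSeed.left_mono {p q : List E} {f : E} {r : List E} (h : IsSeed ι (p ++ q) f r) :
    IsSeed ι q f r := by
  obtain ⟨⟨z, hz⟩, h'⟩ := h
  exact ⟨⟨z * eval ι p, by simpa [mul_assoc] using hz⟩, h'⟩

theorem IsSeed.right_mono {p q : List E} {f : E} {r : List E} (h : IsSeed ι r f (p ++ q)) :
    IsSeed ι r f p := by
  obtain ⟨h', ⟨z, hz⟩⟩ := h
  exact ⟨h', ⟨eval ι q * z, by simpa [mul_assoc] using hz⟩⟩

theorem IsSeed.congr {p p' q q' : List E} {f : E} (h : IsSeed ι p f q)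
    (hp : eval ι p = eval ι p') (hq : eval ι q = eval ι q') : IsSeed ι p' f q' := by
  simpa only [IsSeed, hp, hq] using h

theorem IsBasicProduct.eval_context {e f g : E} (h : IsBasicProduct ι e f g) (p q : List E) :
    eval ι (p ++ e :: f :: q) = eval ι (p ++ g :: q) := by
  simp [← h.1, mul_assoc]

theorem IsBasicProduct.isSeed_of_left {e f g : E} (h : IsBasicProduct ι e f g) {p q : List E}
    (hs : IsSeed ι p e (f :: q)) : IsSeed ι p g q := by
  obtain ⟨⟨z, hz⟩, z', hz'⟩ := hs
  refine ⟨⟨z, ?_⟩, z' * ι f, ?_⟩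
  · rw [← h.1]; simp only [← mul_assoc] at hz ⊢; rw [hz]
  · rw [← h.1]; simp only [eval_cons, ← mul_assoc] at hz' ⊢; rw [hz']

theorem IsBasicProduct.isSeed_of_right {e f g : E} (h : IsBasicProduct ι e f g) {p q : List E}
    (hs : IsSeed ι (p ++ [e]) f q) : IsSeed ι p g q := by
  obtain ⟨⟨z, hz⟩, z', hz'⟩ := hs
  refine ⟨⟨ι e * z, ?_⟩, z', ?_⟩
  · rw [← h.1, mul_assoc]; congr 1; simpa [mul_assoc] using hz
  · rw [← h.1]; simp only [mul_assoc] at hz' ⊢; rw [hz']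

/-- The seed passes to `e` if `g` is 𝓡-related to `e`, and to `f` if `g` is 𝓛-related to `f`. -/
theorem IsBasicProduct.isSeed_or {e f g : E} (h : IsBasicProduct ι e f g) {p q : List E}
    (hs : IsSeed ι p g q) : IsSeed ι p e (f :: q) ∨ IsSeed ι (p ++ [e]) f q := by
  obtain ⟨⟨z, hz⟩, z', hz'⟩ := hs
  rcases h with ⟨hg, ⟨y, hy⟩ | ⟨y, hy⟩⟩
  · left
    refine ⟨⟨z, ?_⟩, z' * y, ?_⟩
    · rw [← hy]; simp only [← mul_assoc] at hz ⊢; rw [hz]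
    · rw [eval_cons, ← mul_assoc, ← mul_assoc, hg, hz', hy]
  · right
    refine ⟨⟨y * z, ?_⟩, z', ?_⟩
    · rw [eval_append, eval_cons, eval_nil, mul_one, mul_assoc (eval ι p), hg, mul_assoc, hz, hy]
    · rw [← hy]; simp only [mul_assoc] at hz' ⊢; rw [hz']

theorem IsBasicProduct.seeded_contract {e f g : E} (h : IsBasicProduct ι e f g) {P Q : List E}
    (hs : Seeded ι (P ++ e :: f :: Q)) : Seeded ι (P ++ g :: Q) := by
  obtain ⟨p, x, q, heq, hs⟩ := hs
  rcases List.append_eq_append_iff.1 heq with ⟨a, rfl, ha⟩ | ⟨a, rfl, ha⟩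
  · match a, ha with
    | [], ha =>
      obtain ⟨rfl, rfl⟩ := List.cons.inj ha
      exact ⟨P, g, Q, rfl, h.isSeed_of_left (by simpa using hs)⟩
    | [_], ha =>
      simp only [List.cons_append, List.nil_append, List.cons.injEq] at ha
      obtain ⟨rfl, rfl, rfl⟩ := ha
      exact ⟨P, g, Q, rfl, h.isSeed_of_right hs⟩
    | _ :: _ :: a, ha =>
      simp only [List.cons_append, List.cons.injEq] at ha
      obtain ⟨rfl, rfl, rfl⟩ := ha
      exact ⟨P ++ g :: a, x, q, by simp, hs.congr (h.eval_context P a) rfl⟩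
  · match a, ha with
    | [], ha =>
      obtain ⟨rfl, rfl⟩ := List.cons.inj ha
      exact ⟨p, g, Q, by simp, h.isSeed_of_left hs⟩
    | _ :: a, ha =>
      obtain ⟨rfl, rfl⟩ := List.cons.inj ha
      exact ⟨p, x, a ++ g :: Q, by simp, hs.congr rfl (h.eval_context a Q)⟩

theorem IsBasicProduct.seeded_expand {e f g : E} (h : IsBasicProduct ι e f g) {P Q : List E}
    (hs : Seeded ι (P ++ g :: Q)) : Seeded ι (P ++ e :: f :: Q) := by
  have key (hs : IsSeed ι P g Q) : Seeded ι (P ++ e :: f :: Q) := by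
    rcases h.isSeed_or hs with hs | hs
    · exact ⟨P, e, f :: Q, rfl, hs⟩
    · exact ⟨P ++ [e], f, Q, by simp, hs⟩
  obtain ⟨p, x, q, heq, hs⟩ := hs
  rcases List.append_eq_append_iff.1 heq with ⟨a, rfl, ha⟩ | ⟨a, rfl, ha⟩
  · match a, ha with
    | [], ha =>
      obtain ⟨rfl, rfl⟩ := List.cons.inj ha
      exact key (by simpa using hs)
    | _ :: a, ha =>
      obtain ⟨rfl, rfl⟩ := List.cons.inj ha
      exact ⟨P ++ e :: f :: a, x, q, by simp, hs.congr (h.eval_context P a).symm rfl⟩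
  · match a, ha with
    | [], ha =>
      obtain ⟨rfl, rfl⟩ := List.cons.inj ha
      exact List.append_nil p ▸ key (by simpa using hs)
    | _ :: a, ha =>
      obtain ⟨rfl, rfl⟩ := List.cons.inj ha
      exact ⟨p, x, a ++ e :: f :: Q, by simp, hs.congr rfl (h.eval_context a Q).symm⟩

theorem Seeded.ne_nil {l : List E} (h : Seeded ι l) : l ≠ [] := by
  rintro rfl
  obtain ⟨p, f, q, h, -⟩ := h
  simp at h

theorem Seeded.of_append_singleton {P : List E} {e : E} (h : Seeded ι (P ++ [e])) :
    IsSeed ι P e [] ∨ ∃ p x q, P = p ++ x :: q ∧ IsSeed ι p x (q ++ [e]) := by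
  obtain ⟨p, x, q, heq, hs⟩ := h
  rcases List.eq_nil_or_concat q with rfl | ⟨q, y, rfl⟩
  · obtain ⟨rfl, h⟩ := List.append_inj' heq rfl
    obtain rfl := List.singleton_inj.1 h
    exact Or.inl hs
  · have : P ++ [e] = (p ++ x :: q) ++ [y] := by simpa using heq
    obtain ⟨rfl, h⟩ := List.append_inj' this rfl
    obtain rfl := List.singleton_inj.1 h
    exact Or.inr ⟨p, x, q, rfl, by simpa using hs⟩

theorem Seeded.of_cons {Q : List E} {f : E} (h : Seeded ι (f :: Q)) :
    IsSeed ι [] f Q ∨ ∃ p x q, Q = p ++ x :: q ∧ IsSeed ι (f :: p) x q := by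
  obtain ⟨p, x, q, heq, hs⟩ := h
  match p, heq with
  | [], heq =>
    obtain ⟨rfl, rfl⟩ := List.cons.inj heq
    exact Or.inl hs
  | _ :: p, heq =>
    obtain ⟨rfl, rfl⟩ := List.cons.inj heq
    exact Or.inr ⟨p, x, q, rfl, hs⟩

/-- Contracting a basic product across the border of two seeded words. -/
theorem IsBasicProduct.seededLength_two {e f g : E} (h : IsBasicProduct ι e f g) {P Q : List E}
    (hPe : Seeded ι (P ++ [e])) (hfQ : Seeded ι (f :: Q)) : SeededLength ι 2 (P ++ g :: Q) := by
  have two {A B : List E} (hA : Seeded ι A) (hB : Seeded ι B) : SeededLength ι 2 (A ++ B) :=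
    ⟨[A, B], by simp, by simp [hA, hB], by simp⟩
  rcases hPe.of_append_singleton with hP | ⟨p, x, q, rfl, hP⟩
  · obtain ⟨⟨z, hz⟩, -⟩ := hP
    have hg : z * (eval ι P * ι g) = ι g := by
      rw [← h.1]; simp only [← mul_assoc] at hz ⊢; rw [hz]
    -- If `e` and `f` are both seeds, the blocks merge into one with seed `g`. If only `e` is, `g`
    -- replaces it and the right block merely loses `f`.
    rcases hfQ.of_cons with ⟨-, z', hz'⟩ | ⟨p', x', q', rfl, hQ⟩
    · have : Seeded ι (P ++ g :: Q) := by
        refine ⟨P, g, Q, rfl, ⟨z, hg⟩, z', ?_⟩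
        rw [← h.1]; simp only [mul_assoc] at hz' ⊢; rw [hz']
      exact ⟨[P ++ g :: Q], by simp, by simpa using this, by simp⟩
    · have h₁ : Seeded ι (P ++ [g]) := ⟨P, g, [], rfl, ⟨z, hg⟩, 1, by simp⟩
      have h₂ : Seeded ι (p' ++ x' :: q') := ⟨p', x', q', rfl, hQ.left_mono (p := [f])⟩
      simpa using two h₁ h₂
  · have hP' : Seeded ι (p ++ x :: q) := ⟨p, x, q, rfl, hP.right_mono⟩
    rcases hfQ.of_cons with ⟨-, z', hz'⟩ | ⟨p', x', q', rfl, hQ⟩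
    · refine two hP' ⟨[], g, Q, rfl, ⟨1, by simp⟩, z', ?_⟩
      rw [← h.1]; simp only [mul_assoc] at hz' ⊢; rw [hz']
    -- Both seeds lie away from the border: `g` joins the left block if it is 𝓡-related to `e`, the
    -- right block if it is 𝓛-related to `f`.
    · rcases h with ⟨hg, ⟨y, hy⟩ | ⟨y, hy⟩⟩
      · have h₁ : Seeded ι ((p ++ x :: q) ++ [g]) := by
          obtain ⟨hl, z, hz⟩ := hP
          refine ⟨p, x, q ++ [g], by simp, hl, y * z, ?_⟩
          simpa [← hy, mul_assoc] using hz
        have h₂ : Seeded ι (p' ++ x' :: q') := ⟨p', x', q', rfl, hQ.left_mono (p := [f])⟩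
        simpa using two h₁ h₂
      · have h₂ : Seeded ι (g :: (p' ++ x' :: q')) := by
          obtain ⟨⟨z, hz⟩, hr⟩ := hQ
          refine ⟨g :: p', x', q', by simp, ⟨z * y, ?_⟩, hr⟩
          simpa [← hy, mul_assoc] using hz
        exact two hP' h₂

end Monoid

theorem exists_of_flatten_eq {α : Type*} {L : List (List α)} {P Q : List α} {g : α}
    (h : L.flatten = P ++ g :: Q) : ∃ L₁ A B L₂, L = L₁ ++ (A ++ g :: B) :: L₂ ∧
      P = L₁.flatten ++ A ∧ Q = B ++ L₂.flatten := by
  induction L generalizing P with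
  | nil => simp at h
  | cons w L ih =>
    rw [List.flatten_cons] at h
    rcases List.append_eq_append_iff.1 h with ⟨a, rfl, ha⟩ | ⟨a, rfl, ha⟩
    · obtain ⟨L₁, A, B, L₂, rfl, rfl, rfl⟩ := ih ha
      exact ⟨w :: L₁, A, B, L₂, by simp, by simp, rfl⟩
    · match a, ha with
      | [], ha =>
        obtain ⟨L₁, A, B, L₂, rfl, hP, rfl⟩ := ih (P := []) (by simpa using ha.symm)
        exact ⟨(P ++ []) :: L₁, A, B, L₂, by simp, by simp [List.append_assoc, ← hP], rfl⟩
      | _ :: a, ha =>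
        obtain ⟨rfl, rfl⟩ := List.cons.inj ha
        exact ⟨[], P, a, L, by simp, by simp, rfl⟩

/-! ### Invariance of seeded length, and long seeded blocks -/

section Monoid

variable {E M : Type*} [Monoid M] {ι : E → M}

theorem SeededLength.append {k m : ℕ} {l l' : List E} (h : SeededLength ι k l)
    (h' : SeededLength ι m l') : SeededLength ι (k + m) (l ++ l') := by
  obtain ⟨L, rfl, hL, hk⟩ := h
  obtain ⟨L', rfl, hL', hk'⟩ := h'
  refine ⟨L ++ L', by simp, fun w hw => ?_, by simp; omega⟩
  rcases List.mem_append.1 hw with hw | hw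
  exacts [hL w hw, hL' w hw]

theorem SeededLength.mono {k m : ℕ} {l : List E} (h : SeededLength ι k l) (hkm : k ≤ m) :
    SeededLength ι m l := by
  obtain ⟨L, hl, hL, hk⟩ := h
  exact ⟨L, hl, hL, hk.trans hkm⟩

theorem Seeded.seededLength {l : List E} (h : Seeded ι l) : SeededLength ι 1 l :=
  ⟨[l], by simp, by simpa using h, by simp⟩

theorem seededLength_flatten {L : List (List E)} (h : ∀ w ∈ L, Seeded ι w) :
    SeededLength ι L.length L.flatten := ⟨L, rfl, h, le_rfl⟩

theorem seededLength_length (l : List E) : SeededLength ι l.length l := by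
  induction l with
  | nil => exact ⟨[], by simp, by simp, by simp⟩
  | cons e l ih =>
    have : Seeded ι [e] := ⟨[], e, [], rfl, ⟨1, by simp⟩, 1, by simp⟩
    exact (this.seededLength.append ih).mono (by simp; omega)

theorem IsBasicProduct.seededLength_contract {e f g : E} (h : IsBasicProduct ι e f g) {k : ℕ}
    {P Q : List E} (hs : SeededLength ι k (P ++ e :: f :: Q)) :
    SeededLength ι k (P ++ g :: Q) := by
  obtain ⟨L, hl, hL, hk⟩ := hs
  obtain ⟨L₁, A, B, L₂, rfl, rfl, hQ⟩ := exists_of_flatten_eq hl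
  simp only [List.mem_append, List.mem_cons, List.length_append, List.length_cons] at hL hk
  have h₁ := seededLength_flatten fun w hw => hL w (Or.inl hw)
  have hA := hL _ (Or.inr (Or.inl rfl))
  have h₂ : ∀ w ∈ L₂, Seeded ι w := fun w hw => hL w (Or.inr (Or.inr hw))
  match B, hQ with
  | _ :: B, hQ =>
    obtain ⟨rfl, rfl⟩ := List.cons.inj hQ
    have := (h₁.append (h.seeded_contract hA).seededLength).append (seededLength_flatten h₂)
    simpa using this.mono (by omega)
  -- Here `e` ends its block; seeded words are nonempty, so `f` starts the next one.
  | [], hQ =>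
    match L₂, hQ with
    | [] :: L₂, hQ => exact absurd rfl (h₂ [] (by simp)).ne_nil
    | (_ :: C) :: L₂, hQ =>
      obtain ⟨rfl, rfl⟩ := List.cons.inj hQ
      have := (h₁.append (h.seededLength_two hA (h₂ (f :: C) (by simp)))).append
        (seededLength_flatten (L := L₂) fun w hw => h₂ w (by simp [hw]))
      simp only [List.length_cons] at hk
      simpa using this.mono (by omega)

theorem IsBasicProduct.seededLength_expand {e f g : E} (h : IsBasicProduct ι e f g) {k : ℕ}
    {P Q : List E} (hs : SeededLength ι k (P ++ g :: Q)) :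
    SeededLength ι k (P ++ e :: f :: Q) := by
  obtain ⟨L, hl, hL, hk⟩ := hs
  obtain ⟨L₁, A, B, L₂, rfl, rfl, rfl⟩ := exists_of_flatten_eq hl
  simp only [List.mem_append, List.mem_cons, List.length_append, List.length_cons] at hL hk
  have h₁ := seededLength_flatten fun w hw => hL w (Or.inl hw)
  have hA := hL _ (Or.inr (Or.inl rfl))
  have h₂ := seededLength_flatten fun w hw => hL w (Or.inr (Or.inr hw))
  simpa using ((h₁.append (h.seeded_expand hA).seededLength).append h₂).mono (by omega)

theorem exists_long_seeded {k n : ℕ} {l : List E} (h : SeededLength ι k l)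
    (hl : k * n < l.length) :
    ∃ A X B, l = A ++ X ++ B ∧ Seeded ι X ∧ n < X.length := by
  obtain ⟨L, rfl, hL, hk⟩ := h
  by_contra! hc
  refine absurd hl (not_lt.2 ?_)
  rw [List.length_flatten]
  refine (List.sum_le_card_nsmul _ n ?_).trans ?_
  · simp only [List.mem_map, forall_exists_index, and_imp, forall_apply_eq_imp_iff₂]
    intro X hX
    obtain ⟨L₁, L₂, rfl⟩ := List.append_of_mem hX
    exact hc L₁.flatten X L₂.flatten (by simp) (hL X hX)
  · simpa using Nat.mul_le_mul_right n hk

theorem exists_seed_of_replicate {k m : ℕ} {w : List E}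
    (h : SeededLength ι k (List.replicate m w).flatten) (hm : k * (4 * w.length) < m * w.length) :
    ∃ u f s, w = u ++ f :: s ∧ ((∃ z, ι f * (eval ι s * eval ι w) * z = ι f) ∨
      ∃ z, z * (eval ι w * eval ι u * ι f) = ι f) := by
  obtain ⟨A, X, B, hl, ⟨p, f, q, rfl, ⟨z, hz⟩, z', hz'⟩, hX⟩ :=
    exists_long_seeded h (by simpa using hm)
  obtain ⟨L₁, u, s, L₂, hL, hu, hs⟩ := exists_of_flatten_eq
    (hl.trans (by simp : _ = (A ++ p) ++ f :: (q ++ B)))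
  have hw : ∀ x ∈ L₁ ++ (u ++ f :: s) :: L₂, x = w := fun x hx =>
    List.eq_of_mem_replicate (hL ▸ hx)
  have hufs : u ++ f :: s = w := hw _ (by simp)
  have hlen := congrArg List.length hufs
  simp only [List.length_append, List.length_cons] at hX hlen
  refine ⟨u, f, s, hufs.symm, ?_⟩
  -- As `p f q` has more than `4 * w.length` letters, `p` or `q` has at least `2 * w.length`, enough
  -- to contain `w u` as a suffix or `s w` as a prefix.
  rcases le_total (2 * w.length) q.length with hq | hq
  · left
    match L₂ with
    | [] =>
      have := congrArg List.length hs
      simp at this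
      omega
    | x :: L₂ =>
      obtain rfl : x = w := hw _ (by simp)
      have h₁ : s ++ x <+: q ++ B := ⟨L₂.flatten, by simpa using hs.symm⟩
      obtain ⟨r, rfl⟩ := List.prefix_of_prefix_length_le h₁ (List.prefix_append q B)
        (by simp only [List.length_append]; omega)
      exact ⟨eval ι r * z', by simpa [mul_assoc] using hz'⟩
  · right
    rcases List.eq_nil_or_concat L₁ with rfl | ⟨L₁, x, rfl⟩
    · have := congrArg List.length hu
      simp at this
      omega
    · obtain rfl : x = w := hw _ (by simp)
      have h₁ : x ++ u <:+ A ++ p := ⟨L₁.flatten, by simpa using hu.symm⟩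
      obtain ⟨r, rfl⟩ := List.suffix_of_suffix_length_le h₁ (List.suffix_append A p)
        (by simp only [List.length_append]; omega)
      exact ⟨z * eval ι r, by simpa [mul_assoc] using hz⟩

end Monoid

/-! ### Periodic one-sided units -/

section Algebra

variable {M : Type*} [Monoid M]

/-- Multiplying on the right by `c` cancels one factor `b`; repeating this reduces the left-hand
power to `f`. -/
theorem pow_eq_of_mul_right_eq {b c f : M} {j d : ℕ} (hbf : b * f = b)
    (hbc : b * c = f) (h : b ^ (j + 1) = b ^ (j + 1 + (d + 1))) : b ^ (d + 1) = f := by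
  have key (n : ℕ) : b ^ (n + 2) * c = b ^ (n + 1) := by
    rw [pow_succ b (n + 1), mul_assoc, hbc, pow_succ, mul_assoc, hbf]
  induction j with
  | zero =>
    have := congrArg (· * c) h
    simp only [zero_add, pow_one, hbc] at this
    rw [this, show 1 + (d + 1) = d + 2 by omega, key]
  | succ j ih =>
    refine ih ?_
    have := congrArg (· * c) h
    simp only [show j + 1 + 1 + (d + 1) = (j + 1 + d) + 2 by omega, key] at this
    exact this

theorem pow_eq_of_mul_left_eq {b c f : M} {j d : ℕ} (hfb : f * b = b)
    (hcb : c * b = f) (h : b ^ (j + 1) = b ^ (j + 1 + (d + 1))) : b ^ (d + 1) = f := by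
  apply MulOpposite.op_injective
  rw [MulOpposite.op_pow]
  refine pow_eq_of_mul_right_eq (c := MulOpposite.op c) (j := j) ?_ ?_ ?_
  · rw [← MulOpposite.op_mul, hfb]
  · rw [← MulOpposite.op_mul, hcb]
  · rw [← MulOpposite.op_pow, ← MulOpposite.op_pow, h]

/-- Let `a = u f s` with `f` idempotent, and let `f s a` be `𝓡`-related to `f` or `a u f` be
`𝓛`-related to `f`. If `a` is periodic, then it has index one. -/
theorem eq_pow_of_seed {u f s : M} {i d : ℕ} (hf : f * f = f)
    (h : (u * f * s) ^ i = (u * f * s) ^ (i + (d + 1)))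
    (hz : (∃ z, f * (s * (u * f * s)) * z = f) ∨ ∃ z, z * (u * f * s * u * f) = f) :
    u * f * s = (u * f * s) ^ (d + 2) := by
  set a := u * f * s with ha
  set b := f * s * u * f with hb
  have hbf : b * f = b := by rw [hb, mul_assoc, hf]
  have hfb : f * b = b := by simp only [hb, ← mul_assoc, hf]
  have hpow (j : ℕ) : b ^ (j + 1) = f * s * a ^ j * (u * f) := by
    induction j with
    | zero => simp [hb, mul_assoc]
    | succ j ih =>
      rw [pow_succ, ih, pow_succ a, hb, ha]
      calc f * s * (u * f * s) ^ j * (u * f) * (f * s * u * f)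
          = f * s * (u * f * s) ^ j * (u * (f * f) * s * u * f) := by simp only [mul_assoc]
        _ = _ := by rw [hf]; simp only [mul_assoc]
  have hper : b ^ (i + 1) = b ^ (i + 1 + (d + 1)) := by
    rw [show i + 1 + (d + 1) = i + (d + 1) + 1 by omega, hpow, hpow, h]
  have hbd : b ^ (d + 1) = f := by
    rcases hz with ⟨z, hz⟩ | ⟨z, hz⟩
    · refine pow_eq_of_mul_right_eq (c := s * z) hbf ?_ hper
      rw [← hz]; simp only [hb, ha, mul_assoc]
    · refine pow_eq_of_mul_left_eq (c := z * u) hfb ?_ hper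
      rw [← hz]; simp only [hb, ha, mul_assoc]
  calc a = u * f * s := ha
    _ = u * (f * f) * s := by rw [hf]
    _ = u * f * b ^ (d + 1) * s := by rw [hbd]; simp only [mul_assoc]
    _ = u * (f * f) * s * a ^ d * (u * f * s) := by rw [hpow]; simp only [mul_assoc]
    _ = a ^ (d + 2) := by rw [hf, ← ha, ← pow_succ', ← pow_succ]

end Algebra

end SeededWord

/-! ### Seeded length as an invariant of elements of `IG E` -/

namespace IG

open SeededWord

variable {E : Type*}

/-- The list of letters of an element of the free semigroup. -/
def letters (x : FreeSemigroup E) : List E := x.head :: x.tail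

theorem letters_mul (x y : FreeSemigroup E) : letters (x * y) = letters x ++ letters y := rfl

variable [BiorderedSet E]

/-- The canonical map from a biordered set into its free idempotent generated semigroup with an
identity adjoined. -/
def letter (e : E) : WithOne (IG E) := ((FreeSemigroup.of e : FreeSemigroup E) : IG E)

theorem letter_mul {e f : E} (h : Dom e f) : letter e * letter f = letter (op e f) := by
  have : ((FreeSemigroup.of e * FreeSemigroup.of f : FreeSemigroup E) : IG E) =
      ((FreeSemigroup.of (op e f) : FreeSemigroup E) : IG E) :=
    (Con.eq _).2 (ConGen.Rel.of _ _ (IGRel.mul e f h))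
  rw [letter, letter, letter, ← WithOne.coe_mul, ← Con.coe_mul, this]

theorem letter_mul_self (e : E) : letter e * letter e = letter e := by
  obtain ⟨h, h'⟩ := BiorderedSet.omegaR_refl e
  rw [letter_mul h, h']

/-- If `e ωʳ f`, then (B21) gives `(ef)e = e`; if `e ωˡ f`, then `ef = e`. The other two cases are
dual. -/
theorem isBasicProduct {e f : E} (h : Dom e f) : IsBasicProduct letter e f (op e f) := by
  refine ⟨letter_mul h, ?_⟩
  rcases (BiorderedSet.dom_iff e f).1 h with h | h | h | h
  · obtain ⟨hd, he⟩ := (BiorderedSet.b21 f e h).1.1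
    exact Or.inl ⟨letter e, by rw [letter_mul hd, he]⟩
  · exact Or.inl ⟨letter e, by rw [h.2, letter_mul_self]⟩
  · exact Or.inr ⟨letter f, by rw [h.2, letter_mul_self]⟩
  · obtain ⟨hd, he⟩ := (BiorderedSet.b21_dual e f h).1.1
    exact Or.inr ⟨letter f, by rw [letter_mul hd, he]⟩

theorem eval_letters (x : FreeSemigroup E) :
    eval letter (letters x) = ((x : IG E) : WithOne (IG E)) := by
  induction x using FreeSemigroup.recOnMul with
  | ih1 e => simp [letters, letter]
  | ih2 e y h₁ h₂ => rw [letters_mul, eval_append, h₁, h₂, ← WithOne.coe_mul, ← Con.coe_mul]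

/-- The context `p`, `q` lets the induction handle a product by changing one factor at a time. -/
theorem seededLength_congr {x y : FreeSemigroup E} (h : conGen (IGRel E) x y) (k : ℕ)
    (p q : List E) : SeededLength letter k (p ++ letters x ++ q) ↔
      SeededLength letter k (p ++ letters y ++ q) := by
  replace h : ConGen.Rel (IGRel E) x y := h
  induction h generalizing p q with
  | of x y h =>
    obtain ⟨e, f, h⟩ := h
    have h' := isBasicProduct h
    constructor
    · intro hs
      simpa [letters] using h'.seededLength_contract (P := p) (Q := q) (by simpa [letters] using hs)
    · intro hs
      simpa [letters] using h'.seededLength_expand (P := p) (Q := q) (by simpa [letters] using hs)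
  | refl x => rfl
  | symm _ ih => exact (ih p q).symm
  | trans _ _ ih ih' => exact (ih p q).trans (ih' p q)
  | @mul w x y z _ _ ih ih' =>
    have h₁ := ih p (letters y ++ q)
    have h₂ := ih' (p ++ letters x) q
    simp only [letters_mul, List.append_assoc] at h₁ h₂ ⊢
    exact h₁.trans h₂

theorem exists_letters (a : IG E) :
    ∃ w : List E, w ≠ [] ∧ eval letter w = (a : WithOne (IG E)) := by
  induction a using Con.induction_on with
  | H x => exact ⟨letters x, by simp [letters], eval_letters x⟩

theorem seededLength_of_eval_eq {l l' : List E} (hl : l ≠ []) (hl' : l' ≠ [])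
    (h : eval letter l = eval letter l') (k : ℕ) (hs : SeededLength letter k l) :
    SeededLength letter k l' := by
  match l, l' with
  | e :: l, e' :: l' =>
    have h' : eval letter (letters (⟨e, l⟩ : FreeSemigroup E)) =
        eval letter (letters (⟨e', l'⟩ : FreeSemigroup E)) := h
    rw [eval_letters, eval_letters, WithOne.coe_inj, Con.eq] at h'
    simpa [letters] using (seededLength_congr h' k [] []).1 (by simpa [letters] using hs)

/-- A periodic element of `IG E` has index one. -/
theorem eq_pow_of_periodic {a : WithOne (IG E)} (ha : a ≠ 1) {i d : ℕ}
    (h : a ^ (i + 1) = a ^ (i + 1 + (d + 1))) : a = a ^ (d + 2) := by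
  obtain ⟨b, rfl⟩ := WithOne.ne_one_iff_exists.1 ha
  obtain ⟨w, hw, hwb⟩ := exists_letters b
  rw [← hwb] at h ⊢
  have hper (t : ℕ) : eval letter w ^ (i + 1) = eval letter w ^ (i + 1 + t * (d + 1)) := by
    induction t with
    | zero => simp
    | succ t ih =>
      rw [show i + 1 + (t + 1) * (d + 1) = i + 1 + (d + 1) + t * (d + 1) by ring,
        pow_add _ (i + 1 + (d + 1)), ← h, ← pow_add, ← ih]
  have hpos : 0 < w.length := List.length_pos_iff.2 hw
  have hne (n : ℕ) : (List.replicate (n + 1) w).flatten ≠ [] := by simp [hw]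
  set k := (List.replicate (i + 1) w).flatten.length
  -- Adding `4 * k` periods makes the number of copies of `w` exceed `4 * k`, while the bound `k` on
  -- the seeded length persists.
  have hs := seededLength_of_eval_eq (hne i) (hne (i + 4 * k * (d + 1)))
    (by rw [eval_replicate_flatten, eval_replicate_flatten, hper (4 * k)]; congr 1; ring) k
    (seededLength_length _)
  obtain ⟨u, f, s, rfl, hz⟩ := exists_seed_of_replicate hs (by nlinarith [Nat.zero_le (k * d)])
  have hw' : eval letter (u ++ f :: s) = eval letter u * letter f * eval letter s := by
    simp [mul_assoc]
  rw [hw'] at h hz ⊢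
  refine eq_pow_of_seed (letter_mul_self f) h ?_
  simpa only [mul_assoc] using hz

end IG

/-! ### From `a = a ^ (d + 2)` to subgroup and index -/

namespace SemigroupElement

variable {S : Type*} [Semigroup S]

theorem coe_powSucc (a : S) (n : ℕ) : ((powSucc a n : S) : WithOne S) = (a : WithOne S) ^ (n + 1) := by
  induction n with
  | zero => simp [powSucc]
  | succ n ih => rw [powSucc, WithOne.coe_mul, ih, ← pow_succ]

theorem powSucc_mem_closure (a : S) (n : ℕ) : powSucc a n ∈ Subsemigroup.closure {a} := by
  induction n with
  | zero => exact Subsemigroup.subset_closure rfl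
  | succ n ih => exact mul_mem ih (Subsemigroup.subset_closure rfl)

theorem IsPeriodic.exists_pow_eq {a : S} (h : IsPeriodic a) :
    ∃ i d : ℕ, (a : WithOne S) ^ (i + 1) = (a : WithOne S) ^ (i + 1 + (d + 1)) := by
  obtain ⟨i, -, j, -, hij, heq⟩ := Set.infinite_univ.exists_lt_map_eq_of_mapsTo
    (f := powSucc a) (fun n _ => powSucc_mem_closure a n) h
  refine ⟨i, j - i - 1, ?_⟩
  rw [show i + 1 + (j - i - 1 + 1) = j + 1 by omega, ← coe_powSucc, ← coe_powSucc, heq]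

/-- The powers of an element, as a subsemigroup. -/
def powers (a : S) : Subsemigroup S where
  carrier := {x | ∃ n, x = powSucc a n}
  mul_mem' := by
    rintro _ _ ⟨m, rfl⟩ ⟨n, rfl⟩
    refine ⟨m + n + 1, WithOne.coe_injective ?_⟩
    rw [WithOne.coe_mul, coe_powSucc, coe_powSucc, coe_powSucc, ← pow_add]
    congr 1; ring

theorem isSubgroup_powers {a : S} {d : ℕ} (h : (a : WithOne S) = (a : WithOne S) ^ (d + 2)) :
    IsSubgroup (powers a) := by
  have key (n : ℕ) : (a : WithOne S) ^ (n + 1 + (d + 1)) = (a : WithOne S) ^ (n + 1) := by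
    rw [show n + 1 + (d + 1) = n + (d + 2) by ring, pow_add, ← h, pow_succ]
  have key' (n t : ℕ) : (a : WithOne S) ^ (n + 1 + t * (d + 1)) = (a : WithOne S) ^ (n + 1) := by
    induction t with
    | zero => simp
    | succ t ih =>
      rw [show n + 1 + (t + 1) * (d + 1) = n + t * (d + 1) + 1 + (d + 1) by ring, key, ← ih]
      congr 1; ring
  refine ⟨powSucc a d, ⟨d, rfl⟩, ?_, ?_⟩
  · rintro _ ⟨n, rfl⟩
    constructor <;> apply WithOne.coe_injective <;>
      rw [WithOne.coe_mul, coe_powSucc, coe_powSucc, ← pow_add, ← key n] <;> (congr 1; ring)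
  · rintro _ ⟨n, rfl⟩
    -- The inverse of `a ^ (n + 1)` is chosen so that the exponents add up to `(n + 2) * (d + 1)`, a
    -- multiple of the period.
    refine ⟨powSucc a (n * d + 2 * d), ⟨_, rfl⟩, ?_, ?_⟩ <;> apply WithOne.coe_injective <;>
      rw [WithOne.coe_mul, coe_powSucc, coe_powSucc, coe_powSucc, ← pow_add, ← key' d (n + 1)] <;>
      (congr 1; ring)

theorem hasIndex_one {a : S} {d : ℕ} (h : (a : WithOne S) = (a : WithOne S) ^ (d + 2)) :
    HasIndex a 1 := by
  refine ⟨⟨d.succPNat, WithOne.coe_injective ?_⟩, fun k _ => one_le⟩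
  rw [ppow, ppow, coe_powSucc, coe_powSucc, PNat.natPred_add_one, PNat.natPred_add_one]
  simpa [add_comm, add_left_comm] using h

end SemigroupElement

theorem IG.exists_eq_pow {E : Type*} [BiorderedSet E] {a : IG E}
    (h : SemigroupElement.IsPeriodic a) :
    ∃ d : ℕ, (a : WithOne (IG E)) = (a : WithOne (IG E)) ^ (d + 2) := by
  obtain ⟨i, d, h⟩ := h.exists_pow_eq
  exact ⟨d, IG.eq_pow_of_periodic WithOne.coe_ne_one h⟩

/-- Every periodic element of the free idempotent generated semigroup on a biordered set lies in a
subgroup of it; in other words, every periodic element has index `1`. -/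
theorem mainTheorem1 (E : Type*) [BiorderedSet E] :
    (∀ a : IG E, SemigroupElement.IsPeriodic a →
      ∃ H : Subsemigroup (IG E), SemigroupElement.IsSubgroup H ∧ a ∈ H) ∧
    (∀ a : IG E, SemigroupElement.IsPeriodic a → SemigroupElement.HasIndex a 1) := by
  refine ⟨fun a ha => ?_, fun a ha => ?_⟩
  · obtain ⟨d, h⟩ := IG.exists_eq_pow ha
    exact ⟨_, SemigroupElement.isSubgroup_powers h, 0, rfl⟩
  · obtain ⟨d, h⟩ := IG.exists_eq_pow ha
    exact SemigroupElement.hasIndex_one h
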